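/- Let $n\ge 1$ and let $\mathfrak S_n$ be the set of permutations of $[n]=\{1,\dots,n\}$. For $\sigma\in\mathfrak S_n$ let $\operatorname{exc}\sigma=\#\{i\in[n]:\sigma(i)>i\}$, and let $\sigma^*:[n]\to\{0,\dots,n-1\}$ be the bijection $\sigma^*(i)=\sigma(i)-1$. Put $$\operatorname{fix}^*\sigma=\#\{i\in[n-1]:\sigma^*(i)=i\},$$ $$\operatorname{cvalley}^*\sigma=\#\{i\in[n-1]:(\sigma^*)^{-1}(i)>i<\sigma^*(i)\},$$ $$\operatorname{cdd}^*\sigma=\#\{i\in[n-1]:(\sigma^*)^{-1}(i)>i>\sigma^*(i)\}.$$ The directed graph on $\{0,\dots,n\}$ with edges $i\to\sigma^*(i)$, $i\in[n]$, consists of disjoint directed cycles (loops included) and one directed path from $n$ to $0$; let $\operatorname{cyc}^*\sigma$ be the number of its cycles (the path is not counted). For $k\ge 0$ define the polynomial $$d_{n,k}(\beta)=\sum_{\substack{\sigma\in\mathfrak S_n\\ \operatorname{cvalley}^*\sigma=k,\ \operatorname{cdd}^*\sigma=0}}\beta^{\operatorname{cyc}^*\sigma-\operatorname{fix}^*\sigma}\in\mathbb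 Z[\beta].$$ Then, in $\mathbb Z[\beta][t]$, $$\sum_{\sigma\in\mathfrak S_n}\beta^{\operatorname{cyc}^*\sigma-\operatorname{fix}^*\sigma}\,t^{\operatorname{exc}\sigma}=\sum_{k=0}^{\lfloor (n-1)/2\rfloor}d_{n,k}(\beta)\,t^k(1+t)^{n-1-2k}.$$ Moreover, for every $k\ge 1$, the polynomial $d_{n,k}(\beta)$ is divisible by $\beta+1$ in $\mathbb Z[\beta]$. -/

import Mathlib

open Polynomial

/-- An index `i : Fin n` stands for the element `i + 1` of `[n] = {1, …, n}`, that is, for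
`i.succ` in `Fin (n + 1) = {0, …, n}`; so `σ : Equiv.Perm (Fin n)` is a permutation of `[n]`.
`starFun σ` is the map `σ* : [n] → {0, …, n-1}`, `σ*(i) = σ(i) - 1`: it sends the element `i.succ`
to `(σ i).succ - 1 = (σ i).castSucc`. Both its arguments and its values are compared
as elements of `Fin (n + 1)`. -/
def starFun {n : ℕ} (σ : Equiv.Perm (Fin n)) (i : Fin n) : Fin (n + 1) :=
  (σ i).castSucc

/-- The number of excedances of `σ`. -/
def excNum {n : ℕ} (σ : Equiv.Perm (Fin n)) : ℕ :=
  (Finset.univ.filter fun i : Fin n => i < σ i).card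

/-- `fix* σ`, the number of `i ∈ [n]` with `σ*(i) = i` (necessarily `i ≤ n - 1`). -/
def fixStar {n : ℕ} (σ : Equiv.Perm (Fin n)) : ℕ :=
  (Finset.univ.filter fun i : Fin n => starFun σ i = i.succ).card

/-- `cvalley* σ`, the number of `x ∈ [n-1]` with `(σ*)⁻¹(x) > x < σ*(x)`. Here `i.succ` is
`(σ*)⁻¹(x)` and `x = j.succ`; such `i` and `j` exist exactly for `x ∈ [n-1]`. -/
def cvalleyStar {n : ℕ} (σ : Equiv.Perm (Fin n)) : ℕ :=
  (Finset.univ.filter fun x : Fin (n + 1) =>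
    ∃ i j : Fin n, starFun σ i = x ∧ j.succ = x ∧ x < i.succ ∧ x < starFun σ j).card

/-- `cdd* σ`, the number of `x ∈ [n-1]` with `(σ*)⁻¹(x) > x > σ*(x)`. -/
def cddStar {n : ℕ} (σ : Equiv.Perm (Fin n)) : ℕ :=
  (Finset.univ.filter fun x : Fin (n + 1) =>
    ∃ i j : Fin n, starFun σ i = x ∧ j.succ = x ∧ x < i.succ ∧ starFun σ j < x).card

/-- The edges `x → σ*(x)`, `x ∈ [n]`, of the diagram of `σ*` on the vertices `0, …, n`. -/
def StarEdge {n : ℕ} (σ : Equiv.Perm (Fin n)) (x y : Fin (n + 1)) : Prop :=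
  ∃ i : Fin n, i.succ = x ∧ starFun σ i = y

/-- The (vertex sets of) cycles of the diagram of `σ*`: the sets of all vertices that can be reached
from some vertex `x` by at least one step, where `x` itself can be so reached. The path
`n → σ*(n) → ⋯ → 0` is not a cycle. -/
def starCycles {n : ℕ} (σ : Equiv.Perm (Fin n)) : Set (Set (Fin (n + 1))) :=
  {C | ∃ x, Relation.TransGen (StarEdge σ) x x ∧ C = {y | Relation.TransGen (StarEdge σ) x y}}

/-- `cyc* σ`, the number of cycles in the diagram of `σ*`. -/
noncomputable def cycStar {n : ℕ} (σ : Equiv.Perm (Fin n)) : ℕ :=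
  (starCycles σ).ncard

/-- A fixed point of `σ*` is a cycle, so the difference `cyc* σ - fix* σ` is never truncated. -/
theorem fixStar_le_cycStar {n : ℕ} (σ : Equiv.Perm (Fin n)) : fixStar σ ≤ cycStar σ := by
  classical
  unfold fixStar cycStar
  rw [← Set.ncard_coe_finset]
  refine Set.ncard_le_ncard_of_injOn (fun i : Fin n => ({i.succ} : Set (Fin (n + 1)))) ?_ ?_
    (Set.toFinite _)
  · intro i hi
    have hi' : starFun σ i = i.succ := by simpa using hi
    have he : StarEdge σ i.succ i.succ := ⟨i, rfl, hi'⟩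
    refine ⟨i.succ, Relation.TransGen.single he, ?_⟩
    ext y
    simp only [Set.mem_singleton_iff, Set.mem_ofPred_eq]
    constructor
    · rintro rfl
      exact Relation.TransGen.single he
    · intro h
      induction h with
      | single h =>
        obtain ⟨j, hj, hy⟩ := h
        rw [Fin.succ_inj.mp hj, hi'] at hy
        exact hy.symm
      | tail _ h ih =>
        obtain ⟨j, hj, hy⟩ := h
        rw [ih] at hj
        rw [Fin.succ_inj.mp hj, hi'] at hy
        exact hy.symm
  · intro i _ j _ h
    exact Fin.succ_inj.mp (Set.singleton_injective h)

/-- `d_{n,k}(β)`, a polynomial in `β = X` with integer coefficients: the sum of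
`β ^ (cyc* σ - fix* σ)` over the permutations of `[n]` with `cvalley* σ = k` and `cdd* σ = 0`. -/
noncomputable def dPoly (n k : ℕ) : ℤ[X] :=
  ∑ σ ∈ Finset.univ.filter (fun σ : Equiv.Perm (Fin n) => cvalleyStar σ = k ∧ cddStar σ = 0),
    X ^ (cycStar σ - fixStar σ)

namespace Equiv.Perm

/-! Adding the edge 0 → n closes the path of σ* and gives a permutation τ of {0, …, n} with τ(0) =
n. Then cyc* − fix* is the number of nontrivial cycles of τ minus one, and exc counts the y ≠ 0 with
y ≤ τ(y) (`cycStar_sub_fixStar`, `excNum_eq`).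

For the expansion, pull x out of its cycle (`hop`). If x is neither a valley nor a peak, the other
elements keep their shapes and the number of nontrivial cycles is unchanged. Above a given ρ fixing
x, double descents at x arise by inserting x into an edge that jumps down over x, ascents from edges
that jump up, and there are equally many of both (`sum_isCycAsc_eq_sum_isCycDesc`). So the weights 1
of a descent and t of an ascent may be replaced by 0 and 1 + t, one x at a time.

For divisibility, set β = −1. A valley v ≠ 0 forces two edges to jump down over the gap above v;
exchanging their targets preserves all shapes and changes the parity of the number of nontrivial
cycles, so the terms cancel (`sum_neg_one_pow_card_cycleType`). -/

theorem symm_apply_eq_self_iff {α : Type*} (τ : Perm α) (x : α) : τ.symm x = x ↔ τ x = x := by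
  rw [Equiv.symm_apply_eq, eq_comm]

/-! ### Cyclic shapes and the removal of one element -/

section Shape

variable {α : Type*} [LinearOrder α]

/-- `x` is a cyclic valley of `τ`. -/
def IsCycValley (τ : Perm α) (x : α) : Prop := x < τ x ∧ x < τ.symm x

/-- `x` is a cyclic double descent of `τ`. -/
def IsCycDesc (τ : Perm α) (x : α) : Prop := τ x < x ∧ x < τ.symm x

/-- `x` is a fixed point or a cyclic double ascent of `τ`. -/
def IsCycAsc (τ : Perm α) (x : α) : Prop := τ x = x ∨ τ.symm x < x ∧ x < τ x

instance (τ : Perm α) : DecidablePred τ.IsCycValley := fun _ => instDecidableAnd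
instance (τ : Perm α) : DecidablePred τ.IsCycDesc := fun _ => instDecidableAnd
instance (τ : Perm α) : DecidablePred τ.IsCycAsc := fun _ => instDecidableOr

/-- `τ` and `τ'` compare `y` in the same way with its image and with its preimage. -/
structure SameShapeAt (τ τ' : Perm α) (y : α) : Prop where
  lt_apply : y < τ y ↔ y < τ' y
  apply_lt : τ y < y ↔ τ' y < y
  lt_symm : y < τ.symm y ↔ y < τ'.symm y
  symm_lt : τ.symm y < y ↔ τ'.symm y < y

namespace SameShapeAt

variable {τ τ' : Perm α} {y : α}

theorem apply_eq (h : SameShapeAt τ τ' y) : τ y = y ↔ τ' y = y := by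
  have h1 := h.lt_apply
  have h2 := h.apply_lt
  rw [← not_iff_not]
  change τ y ≠ y ↔ τ' y ≠ y
  rw [ne_iff_lt_or_gt, ne_iff_lt_or_gt]
  tauto

theorem isCycValley (h : SameShapeAt τ τ' y) : τ.IsCycValley y ↔ τ'.IsCycValley y :=
  and_congr h.lt_apply h.lt_symm

theorem isCycDesc (h : SameShapeAt τ τ' y) : τ.IsCycDesc y ↔ τ'.IsCycDesc y :=
  and_congr h.apply_lt h.lt_symm

theorem isCycAsc (h : SameShapeAt τ τ' y) : τ.IsCycAsc y ↔ τ'.IsCycAsc y :=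
  or_congr h.apply_eq (and_congr h.symm_lt h.lt_apply)

end SameShapeAt

theorem IsCycDesc.not_isCycAsc {τ : Perm α} {x : α} (h : τ.IsCycDesc x) : ¬ τ.IsCycAsc x := by
  rintro (h' | h')
  · exact h.1.ne h'
  · exact lt_asymm h.1 h'.2

theorem lt_apply_iff (τ : Perm α) (x : α) :
    x < τ x ↔ τ.IsCycValley x ∨ τ.IsCycAsc x ∧ τ x ≠ x := by
  unfold IsCycValley IsCycAsc
  constructor
  · intro h
    rcases lt_trichotomy x (τ.symm x) with h' | h' | h'
    · exact Or.inl ⟨h, h'⟩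
    · exact absurd ((symm_apply_eq_self_iff τ x).1 h'.symm) h.ne'
    · exact Or.inr ⟨Or.inr ⟨h', h⟩, h.ne'⟩
  · rintro (h | ⟨h | h, h'⟩)
    · exact h.1
    · exact absurd h h'
    · exact h.2

theorem le_apply_iff (τ : Perm α) (x : α) :
    x ≤ τ x ↔ τ.IsCycValley x ∨ τ.IsCycAsc x := by
  rw [le_iff_lt_or_eq, lt_apply_iff]
  by_cases h : τ x = x
  · simp [h, IsCycAsc]
  · simp [h, Ne.symm h]

/-- Remove `x` from its cycle. -/
def hop (τ : Perm α) (x : α) : Perm α := τ * swap (τ.symm x) x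

theorem hop_apply_self (τ : Perm α) (x : α) : τ.hop x x = x := by
  simp [hop]

theorem hop_of_apply_eq {τ : Perm α} {x : α} (h : τ x = x) : τ.hop x = τ := by
  have : τ.symm x = x := (symm_apply_eq_self_iff τ x).2 h
  rw [hop, this, swap_self]
  exact mul_one τ

theorem hop_apply_symm (τ : Perm α) (x : α) : τ.hop x (τ.symm x) = τ x := by
  simp [hop]

theorem hop_apply_of_ne {τ : Perm α} {x y : α} (h : y ≠ x) (h' : y ≠ τ.symm x) :
    τ.hop x y = τ y := by
  rw [hop, mul_apply, swap_apply_of_ne_of_ne h' h]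

theorem hop_symm_apply (τ : Perm α) (x y : α) :
    (τ.hop x).symm y = swap (τ.symm x) x (τ.symm y) :=
  rfl

/-- For a fixed point x of ρ, `ρ * swap c x` inserts x into the edge c → ρ c. This is the inverse
operation of `hop`. -/
theorem mul_swap_symm_apply {ρ : Perm α} {x : α} (h : ρ x = x) (c : α) :
    (ρ * swap c x).symm x = c := by
  rw [Equiv.symm_apply_eq, mul_apply, swap_apply_left, h]

theorem hop_mul_swap {ρ : Perm α} {x : α} (h : ρ x = x) (c : α) : (ρ * swap c x).hop x = ρ := by
  rw [hop, mul_swap_symm_apply h, mul_swap_mul_self]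

theorem hop_mul_swap_symm (τ : Perm α) (x : α) : τ.hop x * swap (τ.symm x) x = τ := by
  simp [hop, mul_assoc]

/-- Removing an element that is neither a valley nor a peak does not change the others. -/
theorem sameShapeAt_hop {τ : Perm α} {x y : α} (hx : τ.IsCycAsc x ∨ τ.IsCycDesc x) (hy : y ≠ x) :
    SameShapeAt τ (τ.hop x) y := by
  by_cases hf : τ x = x
  · rw [hop_of_apply_eq hf]
    exact ⟨Iff.rfl, Iff.rfl, Iff.rfl, Iff.rfl⟩
  have hf' : τ.symm x ≠ x := fun h => hf ((symm_apply_eq_self_iff τ x).1 h)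
  -- Here x lies strictly between τ⁻¹ x and τ x, so both neighbours of x see x and its replacement
  -- on the same side.
  have hout : (y < τ y ↔ y < τ.hop x y) ∧ (τ y < y ↔ τ.hop x y < y) := by
    by_cases ha : y = τ.symm x
    · subst ha
      rw [hop_apply_symm, Equiv.apply_symm_apply]
      rcases hx with (h | ⟨h1, h2⟩) | ⟨h1, h2⟩
      · exact absurd h hf
      · have := h1.trans h2
        simp [h1, this, h1.not_gt, this.not_gt]
      · have := h1.trans h2
        simp [h2, this, h2.not_gt, this.not_gt]
    · rw [hop_apply_of_ne hy ha]
      exact ⟨Iff.rfl, Iff.rfl⟩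
  have hin : (y < τ.symm y ↔ y < (τ.hop x).symm y) ∧ (τ.symm y < y ↔ (τ.hop x).symm y < y) := by
    rw [hop_symm_apply]
    by_cases hb : y = τ x
    · subst hb
      rw [Equiv.symm_apply_apply, swap_apply_right]
      rcases hx with (h | ⟨h1, h2⟩) | ⟨h1, h2⟩
      · exact absurd h hf
      · have := h1.trans h2
        simp [h2, this, h2.not_gt, this.not_gt]
      · have := h1.trans h2
        simp [h1, this, h1.not_gt, this.not_gt]
    · rw [swap_apply_of_ne_of_ne]
      · exact ⟨Iff.rfl, Iff.rfl⟩
      · exact fun h => hy (τ.symm.injective h)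
      · exact fun h => hb (by rw [← h, Equiv.apply_symm_apply])
  exact ⟨hout.1, hout.2, hin.1, hin.2⟩

theorem hop_eq_swap_mul (τ : Perm α) (x : α) : τ.hop x = swap x (τ x) * τ := by
  rw [hop, mul_swap_eq_swap_mul, Equiv.apply_symm_apply]

section Bounded

variable [BoundedOrder α] [Nontrivial α] {τ : Perm α}

theorem isCycValley_bot (h : τ ⊥ = ⊤) : τ.IsCycValley ⊥ := by
  refine ⟨h ▸ bot_lt_top, bot_lt_iff_ne_bot.2 fun h' => ?_⟩
  rw [symm_apply_eq_self_iff, h] at h'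
  exact top_ne_bot h'

theorem ne_bot_of_isCycAsc_or_isCycDesc (h : τ ⊥ = ⊤) {x : α}
    (hx : τ.IsCycAsc x ∨ τ.IsCycDesc x) : x ≠ ⊥ := by
  rintro rfl
  rcases hx with (h' | h') | h'
  · exact top_ne_bot (h ▸ h')
  · exact not_lt_bot h'.1
  · exact not_lt_bot h'.1

theorem ne_top_of_isCycAsc_or_isCycDesc (h : τ ⊥ = ⊤) {x : α}
    (hx : τ.IsCycAsc x ∨ τ.IsCycDesc x) : x ≠ ⊤ := by
  rintro rfl
  rcases hx with (h' | h') | h'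
  · exact top_ne_bot (τ.injective (h'.trans h.symm))
  · exact not_top_lt h'.2
  · exact not_top_lt h'.2

theorem hop_bot (h : τ ⊥ = ⊤) {x : α} (hx : τ.IsCycAsc x ∨ τ.IsCycDesc x) : τ.hop x ⊥ = ⊤ := by
  rw [hop_apply_of_ne (ne_bot_of_isCycAsc_or_isCycDesc h hx).symm, h]
  intro h'
  apply ne_top_of_isCycAsc_or_isCycDesc h hx
  rw [← h, h', Equiv.apply_symm_apply]

end Bounded

variable [Fintype α]

/-- As many edges of the diagram of `τ` cross the gap above `v` upwards as downwards. -/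
theorem card_up_crossing_eq_card_down_crossing (τ : Perm α) (v : α) :
    (Finset.univ.filter fun c => c ≤ v ∧ v < τ c).card =
      (Finset.univ.filter fun c => v < c ∧ τ c ≤ v).card := by
  have h1 := Finset.card_filter_add_card_filter_not
    (s := Finset.univ.filter fun c => c ≤ v) (fun c => τ c ≤ v)
  have h2 := Finset.card_filter_add_card_filter_not
    (s := Finset.univ.filter fun c => τ c ≤ v) (fun c => c ≤ v)
  have h3 : (Finset.univ.filter fun c => τ c ≤ v).card =
      (Finset.univ.filter fun c => c ≤ v).card :=
    Finset.card_bij' (fun c _ => τ c) (fun c _ => τ.symm c) (by simp) (by simp) (by simp) (by simp)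
  simp only [Finset.filter_filter, not_le] at h1 h2
  simp only [and_comm (a := τ _ ≤ v)] at h2
  omega

/-- Only the cycle through x is affected. It has length at least 3, so it remains a nontrivial cycle
after losing x. -/
theorem card_cycleType_eq_of_isCycle_swap_mul {τ : Perm α} {x : α} (h1 : τ x ≠ x)
    (h2 : τ (τ x) ≠ x) :
    Multiset.card (swap x (τ x) * τ).cycleType = Multiset.card τ.cycleType := by
  set f := τ.cycleOf x with hf
  have hmem : f ∈ τ.cycleFactorsFinset :=
    cycleOf_mem_cycleFactorsFinset_iff.2 (mem_support.2 h1)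
  have hfx : f x = τ x := cycleOf_apply_self τ x
  have hffx : f (f x) = τ (τ x) := by
    rw [hfx]
    exact (SameCycle.refl τ x).apply_right.cycleOf_apply
  have hcf : f.IsCycle := isCycle_cycleOf τ h1
  have hdis : Disjoint f (τ * f⁻¹) := (disjoint_mul_inv_of_mem_cycleFactorsFinset hmem).symm
  have hτ : τ = f * (τ * f⁻¹) := by
    rw [hdis.commute.eq, inv_mul_cancel_right]
  have hcyc : (swap x (f x) * f).IsCycle :=
    hcf.swap_mul (by rwa [hfx]) (by rwa [hffx])
  have hdis' : Disjoint (swap x (f x) * f) (τ * f⁻¹) := by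
    rw [disjoint_iff_disjoint_support] at hdis ⊢
    refine hdis.mono_left fun y hy => ?_
    rw [mem_support] at hy ⊢
    intro h
    apply hy
    rw [mul_apply, h, swap_apply_of_ne_of_ne]
    · rintro rfl
      exact h1 (hfx ▸ h)
    · rintro rfl
      exact h1 (hfx ▸ f.injective h)
  have e : swap x (τ x) * τ = (swap x (f x) * f) * (τ * f⁻¹) := by
    rw [mul_assoc, ← hτ, hfx]
  rw [e, hdis'.cycleType_mul]
  conv_rhs => rw [hτ, hdis.cycleType_mul]
  rw [Multiset.card_add, Multiset.card_add, card_cycleType_eq_one.2 hcyc,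
    card_cycleType_eq_one.2 hcf]

/-- In a 2-cycle τ⁻¹ x = τ x, which would make x a valley or a peak. -/
theorem card_cycleType_hop {τ : Perm α} {x : α} (hx : τ.IsCycAsc x ∨ τ.IsCycDesc x) :
    Multiset.card (τ.hop x).cycleType = Multiset.card τ.cycleType := by
  by_cases hf : τ x = x
  · rw [hop_of_apply_eq hf]
  rw [hop_eq_swap_mul]
  apply card_cycleType_eq_of_isCycle_swap_mul hf
  intro h
  have h' : τ.symm x = τ x := by rw [Equiv.symm_apply_eq, h]
  unfold IsCycAsc IsCycDesc at hx
  rw [h'] at hx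
  rcases hx with (h | ⟨a, b⟩) | ⟨a, b⟩
  · exact hf h
  · exact lt_asymm a b
  · exact lt_asymm a b

/-! ### Fibres of the removal map -/

section Bounded

variable [BoundedOrder α] [Nontrivial α]

theorem card_hop_fibre_desc {ρ : Perm α} (hρ : ρ ⊥ = ⊤) {x : α} (hx : ρ x = x) :
    (Finset.univ.filter fun τ : Perm α => (τ ⊥ = ⊤ ∧ τ.IsCycDesc x) ∧ τ.hop x = ρ).card =
      (Finset.univ.filter fun c => x < c ∧ ρ c ≤ x).card := by
  refine Finset.card_bij' (fun τ _ => τ.symm x) (fun c _ => ρ * swap c x) ?_ ?_ ?_ ?_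
  · intro τ hτ
    obtain ⟨⟨-, h1, h2⟩, rfl⟩ := (Finset.mem_filter.1 hτ).2
    simp only [Finset.mem_filter, Finset.mem_univ, true_and, hop_apply_symm]
    exact ⟨h2, h1.le⟩
  · intro c hc
    obtain ⟨h1, h2⟩ := (Finset.mem_filter.1 hc).2
    have h3 : ρ c ≠ x := fun h => h1.ne' (ρ.injective (h.trans hx.symm))
    have hb : ⊥ ≠ c := (bot_le.trans_lt h1).ne
    have hb' : (⊥ : α) ≠ x := by
      rintro rfl
      exact top_ne_bot (hρ ▸ hx)
    simp only [Finset.mem_filter, Finset.mem_univ, true_and, hop_mul_swap hx, and_true]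
    refine ⟨by rw [mul_apply, swap_apply_of_ne_of_ne hb hb', hρ], ?_, ?_⟩
    · simpa using lt_of_le_of_ne h2 h3
    · rwa [mul_swap_symm_apply hx]
  · intro τ hτ
    obtain ⟨-, rfl⟩ := (Finset.mem_filter.1 hτ).2
    exact hop_mul_swap_symm τ x
  · intro c hc
    exact mul_swap_symm_apply hx c

/-- Inserting x into the upward edge ⊥ → ⊤ would destroy τ ⊥ = ⊤. That edge stands instead for
leaving x fixed, which is why fixed points count as ascents. -/
theorem card_hop_fibre_asc {ρ : Perm α} (hρ : ρ ⊥ = ⊤) {x : α} (hx : ρ x = x) :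
    (Finset.univ.filter fun τ : Perm α => (τ ⊥ = ⊤ ∧ τ.IsCycAsc x) ∧ τ.hop x = ρ).card =
      (Finset.univ.filter fun c => c ≤ x ∧ x < ρ c).card := by
  have hxb : x ≠ ⊥ := by
    rintro rfl
    exact top_ne_bot (hρ ▸ hx)
  have hxt : x ≠ ⊤ := by
    rintro rfl
    exact top_ne_bot (ρ.injective (hx.trans hρ.symm))
  refine Finset.card_bij' (fun τ _ => if τ x = x then ⊥ else τ.symm x)
    (fun c _ => if c = ⊥ then ρ else ρ * swap c x) ?_ ?_ ?_ ?_
  · intro τ hτ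
    obtain ⟨⟨h0, h⟩, rfl⟩ := (Finset.mem_filter.1 hτ).2
    simp only [Finset.mem_filter, Finset.mem_univ, true_and]
    split_ifs with hf
    · exact ⟨bot_le, by rw [hρ]; exact hxt.lt_top⟩
    · rcases h with h | ⟨h1, h2⟩
      · exact absurd h hf
      · rw [hop_apply_symm]
        exact ⟨h1.le, h2⟩
  · intro c hc
    obtain ⟨h1, h2⟩ := (Finset.mem_filter.1 hc).2
    have h3 : c ≠ x := by
      rintro rfl
      exact h2.ne' hx
    simp only [Finset.mem_filter, Finset.mem_univ, true_and]
    split_ifs with hc0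
    · exact ⟨⟨hρ, Or.inl hx⟩, hop_of_apply_eq hx⟩
    · refine ⟨⟨by rw [mul_apply, swap_apply_of_ne_of_ne (Ne.symm hc0) hxb.symm, hρ], ?_⟩,
        hop_mul_swap hx c⟩
      refine Or.inr ⟨?_, ?_⟩
      · rw [mul_swap_symm_apply hx]
        exact lt_of_le_of_ne h1 h3
      · simpa using h2
  · intro τ hτ
    obtain ⟨⟨h0, h⟩, rfl⟩ := (Finset.mem_filter.1 hτ).2
    by_cases hf : τ x = x
    · simp [hf, hop_of_apply_eq hf]
    · have : τ.symm x ≠ ⊥ := by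
        intro h'
        exact hxt (by rw [← h0, ← h', Equiv.apply_symm_apply])
      simp only [hf, this, if_false]
      exact hop_mul_swap_symm τ x
  · intro c hc
    obtain ⟨h1, h2⟩ := (Finset.mem_filter.1 hc).2
    by_cases hc0 : c = ⊥
    · simp [hc0, hx]
    · have : ρ c ≠ x := h2.ne'
      simp only [hc0, if_false, mul_swap_symm_apply hx, mul_apply, swap_apply_right, this]

/-- Φ is constant on the fibres of `hop`, whose sizes on the two sides are the numbers of upward and
downward crossings above x in the same ρ. -/
theorem sum_isCycAsc_eq_sum_isCycDesc {M : Type*} [AddCommMonoid M] (Φ : Perm α → M) (x : α)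
    (hΦ : ∀ τ : Perm α, τ.IsCycAsc x ∨ τ.IsCycDesc x → Φ (τ.hop x) = Φ τ) :
    ∑ τ ∈ Finset.univ.filter (fun τ : Perm α => τ ⊥ = ⊤ ∧ τ.IsCycAsc x), Φ τ =
      ∑ τ ∈ Finset.univ.filter (fun τ : Perm α => τ ⊥ = ⊤ ∧ τ.IsCycDesc x), Φ τ := by
  have key : ∀ p : Perm α → Prop, ∀ [DecidablePred p],
      (∀ τ, p τ → τ.IsCycAsc x ∨ τ.IsCycDesc x) →
      ∑ τ ∈ Finset.univ.filter (fun τ : Perm α => τ ⊥ = ⊤ ∧ p τ), Φ τ =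
        ∑ ρ ∈ Finset.univ.filter (fun ρ : Perm α => ρ ⊥ = ⊤ ∧ ρ x = x),
          (Finset.univ.filter fun τ : Perm α => (τ ⊥ = ⊤ ∧ p τ) ∧ τ.hop x = ρ).card • Φ ρ := by
    intro p _ hp
    rw [← Finset.sum_fiberwise_of_maps_to (g := fun τ : Perm α => τ.hop x)
      (t := Finset.univ.filter fun ρ : Perm α => ρ ⊥ = ⊤ ∧ ρ x = x)]
    · refine Finset.sum_congr rfl fun ρ _ => ?_
      rw [Finset.filter_filter]
      apply Finset.sum_eq_card_nsmul
      intro τ hτ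
      obtain ⟨⟨-, h⟩, rfl⟩ := (Finset.mem_filter.1 hτ).2
      exact (hΦ τ (hp τ h)).symm
    · intro τ hτ
      obtain ⟨h0, h⟩ := (Finset.mem_filter.1 hτ).2
      simp [hop_bot h0 (hp τ h), hop_apply_self]
  rw [key _ fun _ => Or.inl, key _ fun _ => Or.inr]
  refine Finset.sum_congr rfl fun ρ hρ => ?_
  obtain ⟨h0, h⟩ := (Finset.mem_filter.1 hρ).2
  rw [card_hop_fibre_asc h0 h, card_hop_fibre_desc h0 h, card_up_crossing_eq_card_down_crossing]

end Bounded

end Shape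

/-! ### The γ-expansion -/

section Gamma

variable {α : Type*} [LinearOrder α]

theorem IsCycValley.not_isCycAsc {τ : Perm α} {x : α} (h : τ.IsCycValley x) : ¬ τ.IsCycAsc x := by
  rintro (h' | h')
  · exact h.1.ne' h'
  · exact lt_asymm h.2 h'.1

/-- The factor contributed by `y` to the weight of `τ`: the contributions `1` of a double descent
and `t` of a double ascent have been moved entirely to the double ascents for `y ∈ S`. -/
def gammaFactor {R : Type*} [CommRing R] (t : R) (S : Finset α) (τ : Perm α) (y : α) : R :=
  if τ.IsCycDesc y then (if y ∈ S then 0 else 1)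
  else if τ.IsCycAsc y then (if y ∈ S then 1 + t else t)
  else if τ.IsCycValley y then t else 1

variable [Fintype α]

/-- The factor 2 accounts for the peaks: counting downward edges by source gives descents and peaks,
by target descents and valleys. -/
theorem card_isCycDesc_add (τ : Perm α) :
    (Finset.univ.filter fun y => τ.IsCycDesc y).card +
      2 * (Finset.univ.filter fun y => τ.IsCycValley y).card +
      (Finset.univ.filter fun y => τ.IsCycAsc y).card = Fintype.card α := by
  have h1 : (Finset.univ.filter fun y => τ y < y).card =
      (Finset.univ.filter fun y => y < τ.symm y).card :=
    Finset.card_bij' (fun c _ => τ c) (fun c _ => τ.symm c) (by simp) (by simp) (by simp) (by simp)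
  have h2 := Finset.card_filter_add_card_filter_not
    (s := Finset.univ.filter fun y => y < τ.symm y) (fun y => τ y < y)
  have h3 := Finset.card_filter_add_card_filter_not
    (s := (Finset.univ : Finset α)) (fun y => τ y < y)
  have h4 : (Finset.univ.filter fun y => ¬ τ y < y).card =
      (Finset.univ.filter fun y => τ.IsCycValley y).card +
        (Finset.univ.filter fun y => τ.IsCycAsc y).card := by
    rw [← Finset.card_union_of_disjoint, ← Finset.filter_or]
    · simp only [not_lt, le_apply_iff]
    · exact Finset.disjoint_filter.2 fun y _ h => h.not_isCycAsc
  have h5 : (Finset.univ.filter fun y => y < τ.symm y).filter (fun y => τ y < y) =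
      Finset.univ.filter fun y => τ.IsCycDesc y := by
    rw [Finset.filter_filter]
    exact Finset.filter_congr fun y _ => and_comm
  have h6 : (Finset.univ.filter fun y => y < τ.symm y).filter (fun y => ¬ τ y < y) =
      Finset.univ.filter fun y => τ.IsCycValley y := by
    rw [Finset.filter_filter]
    refine Finset.filter_congr fun y _ => ⟨fun h => ⟨?_, h.1⟩, fun h => ⟨h.2, h.1.not_gt⟩⟩
    refine lt_of_le_of_ne (not_lt.1 h.2) fun h' => h.1.ne' ?_
    exact (symm_apply_eq_self_iff τ y).2 h'.symm
  rw [h5, h6] at h2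
  rw [Finset.card_univ] at h3
  omega

variable [BoundedOrder α] {R : Type*} [CommRing R]

theorem prod_gammaFactor_empty (t : R) (τ : Perm α) :
    ∏ y ∈ Finset.univ.erase ⊥, gammaFactor t ∅ τ y =
      t ^ (Finset.univ.filter fun y => y ≠ ⊥ ∧ y ≤ τ y).card := by
  have h : ∀ y, gammaFactor t ∅ τ y = if y ≤ τ y then t else 1 := by
    intro y
    rw [gammaFactor]
    by_cases hd : τ.IsCycDesc y
    · simp [hd, hd.1.not_ge]
    · simp only [hd, if_false, le_apply_iff, Finset.notMem_empty]
      by_cases ha : τ.IsCycAsc y <;> simp [ha]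
  rw [Finset.prod_congr rfl fun y _ => h y, Finset.prod_ite, Finset.prod_const, Finset.prod_const_one,
    mul_one, ← Finset.filter_ne', Finset.filter_filter]

variable [Nontrivial α]

theorem card_isCycValley_eq {τ : Perm α} (h0 : τ ⊥ = ⊤) :
    (Finset.univ.filter fun y => τ.IsCycValley y).card =
      (Finset.univ.filter fun y => y ≠ ⊥ ∧ τ.IsCycValley y).card + 1 := by
  rw [← Finset.card_erase_add_one (a := ⊥) (by simp [isCycValley_bot h0])]
  congr 2
  ext y
  simp

/-- Adding x to S changes the weight by +Q on ascents at x and −Q on descents at x, where Q collects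
Φ and the factors of the other elements and is invariant under `hop`. -/
theorem sum_prod_gammaFactor_insert (t : R) (Φ : Perm α → R) {S : Finset α} {x : α} (hx : x ∉ S)
    (hx0 : x ≠ ⊥)
    (hΦ : ∀ τ : Perm α, τ.IsCycAsc x ∨ τ.IsCycDesc x → Φ (τ.hop x) = Φ τ) :
    ∑ τ ∈ Finset.univ.filter (fun τ : Perm α => τ ⊥ = ⊤),
        Φ τ * ∏ y ∈ Finset.univ.erase ⊥, gammaFactor t (insert x S) τ y =
      ∑ τ ∈ Finset.univ.filter (fun τ : Perm α => τ ⊥ = ⊤),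
        Φ τ * ∏ y ∈ Finset.univ.erase ⊥, gammaFactor t S τ y := by
  set Q : Perm α → R := fun τ => Φ τ * ∏ y ∈ (Finset.univ.erase ⊥).erase x, gammaFactor t S τ y
    with hQ
  have hQinv : ∀ τ : Perm α, τ.IsCycAsc x ∨ τ.IsCycDesc x → Q (τ.hop x) = Q τ := by
    intro τ hτ
    simp only [hQ, hΦ τ hτ]
    congr 1
    refine Finset.prod_congr rfl fun y hy => ?_
    have hs := sameShapeAt_hop hτ (Finset.ne_of_mem_erase hy)
    simp only [gammaFactor, hs.isCycDesc, hs.isCycAsc, hs.isCycValley]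
  have hmem : x ∈ Finset.univ.erase (⊥ : α) := by simp [hx0]
  have hdiff : ∀ τ : Perm α,
      Φ τ * ∏ y ∈ Finset.univ.erase ⊥, gammaFactor t (insert x S) τ y -
        Φ τ * ∏ y ∈ Finset.univ.erase ⊥, gammaFactor t S τ y =
      (if τ.IsCycAsc x then Q τ else 0) - (if τ.IsCycDesc x then Q τ else 0) := by
    intro τ
    have e : ∏ y ∈ (Finset.univ.erase (⊥ : α)).erase x, gammaFactor t (insert x S) τ y =
        ∏ y ∈ (Finset.univ.erase (⊥ : α)).erase x, gammaFactor t S τ y := by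
      refine Finset.prod_congr rfl fun y hy => ?_
      simp only [gammaFactor, Finset.mem_insert, Finset.ne_of_mem_erase hy, false_or]
    rw [← Finset.mul_prod_erase _ _ hmem, ← Finset.mul_prod_erase _ _ hmem, e]
    simp only [hQ]
    by_cases hd : τ.IsCycDesc x
    · simp [gammaFactor, hd, hd.not_isCycAsc, hx]
    · by_cases ha : τ.IsCycAsc x
      · simp only [gammaFactor, hd, ha, hx, if_true, if_false, Finset.mem_insert_self]
        ring
      · simp [gammaFactor, hd, ha]
  rw [← sub_eq_zero, ← Finset.sum_sub_distrib, Finset.sum_congr rfl fun τ _ => hdiff τ,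
    Finset.sum_sub_distrib, ← Finset.sum_filter, ← Finset.sum_filter, Finset.filter_filter,
    Finset.filter_filter, sub_eq_zero]
  exact sum_isCycAsc_eq_sum_isCycDesc Q x hQinv

theorem prod_gammaFactor_univ (t : R) (τ : Perm α) (h0 : τ ⊥ = ⊤) :
    ∏ y ∈ Finset.univ.erase ⊥, gammaFactor t (Finset.univ.erase ⊥) τ y =
      if (Finset.univ.filter fun y => τ.IsCycDesc y).card = 0 then
        t ^ (Finset.univ.filter fun y => y ≠ ⊥ ∧ τ.IsCycValley y).card *
          (1 + t) ^ (Fintype.card α - 2 -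
            2 * (Finset.univ.filter fun y => y ≠ ⊥ ∧ τ.IsCycValley y).card)
      else 0 := by
  split_ifs with h
  · have hd : ∀ y, ¬ τ.IsCycDesc y := by simpa using h
    have hg : ∀ y ∈ Finset.univ.erase (⊥ : α), gammaFactor t (Finset.univ.erase ⊥) τ y =
        (if τ.IsCycValley y then t else 1) * (if τ.IsCycAsc y then 1 + t else 1) := by
      intro y hy
      by_cases ha : τ.IsCycAsc y
      · have hv : ¬ τ.IsCycValley y := fun hv => hv.not_isCycAsc ha
        simp only [gammaFactor, hd y, ha, hv, hy, if_true, if_false, one_mul]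
      · simp only [gammaFactor, hd y, ha, if_false, mul_one]
    have hcard := card_isCycDesc_add τ
    have hv := card_isCycValley_eq h0
    have ha : (Finset.univ.filter fun y => y ≠ ⊥ ∧ τ.IsCycAsc y) =
        Finset.univ.filter fun y => τ.IsCycAsc y :=
      Finset.filter_congr fun y _ => and_iff_right_of_imp fun h' =>
        ne_bot_of_isCycAsc_or_isCycDesc h0 (Or.inl h')
    -- The valley ⊥ is left out of this count; it accounts for the 2 subtracted.
    have e : Fintype.card α - 2 -
        2 * (Finset.univ.filter fun y => y ≠ ⊥ ∧ τ.IsCycValley y).card =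
        (Finset.univ.filter fun y => τ.IsCycAsc y).card := by
      omega
    rw [e, Finset.prod_congr rfl hg, Finset.prod_mul_distrib, Finset.prod_ite, Finset.prod_ite]
    simp only [Finset.prod_const, one_pow, mul_one, ← Finset.filter_ne',
      Finset.filter_filter, ha]
  · obtain ⟨y, hy⟩ := Finset.card_pos.1 (Nat.pos_of_ne_zero h)
    have hy' : τ.IsCycDesc y := (Finset.mem_filter.1 hy).2
    have hy0 : y ∈ Finset.univ.erase (⊥ : α) := by
      simp [ne_bot_of_isCycAsc_or_isCycDesc h0 (Or.inr hy')]
    refine Finset.prod_eq_zero hy0 ?_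
    simp only [gammaFactor, hy', hy0, if_true]

/-- The `γ`-expansion, for weights that do not change when an element which is neither a valley nor
a peak is removed from its cycle. -/
theorem sum_mul_pow_eq_gamma_expansion (t : R) (Φ : Perm α → R)
    (hΦ : ∀ (τ : Perm α) (x : α), τ.IsCycAsc x ∨ τ.IsCycDesc x → Φ (τ.hop x) = Φ τ) :
    ∑ τ ∈ Finset.univ.filter (fun τ : Perm α => τ ⊥ = ⊤),
        Φ τ * t ^ (Finset.univ.filter fun y => y ≠ ⊥ ∧ y ≤ τ y).card =
      ∑ τ ∈ Finset.univ.filter (fun τ : Perm α => τ ⊥ = ⊤),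
        Φ τ * if (Finset.univ.filter fun y => τ.IsCycDesc y).card = 0 then
          t ^ (Finset.univ.filter fun y => y ≠ ⊥ ∧ τ.IsCycValley y).card *
            (1 + t) ^ (Fintype.card α - 2 -
              2 * (Finset.univ.filter fun y => y ≠ ⊥ ∧ τ.IsCycValley y).card)
        else 0 := by
  have key : ∀ S : Finset α, ⊥ ∉ S →
      ∑ τ ∈ Finset.univ.filter (fun τ : Perm α => τ ⊥ = ⊤),
        Φ τ * ∏ y ∈ Finset.univ.erase ⊥, gammaFactor t S τ y =
      ∑ τ ∈ Finset.univ.filter (fun τ : Perm α => τ ⊥ = ⊤),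
        Φ τ * ∏ y ∈ Finset.univ.erase ⊥, gammaFactor t ∅ τ y := by
    intro S
    induction S using Finset.induction_on with
    | empty => exact fun _ => rfl
    | insert x S hx ih =>
      intro h
      rw [Finset.mem_insert, not_or] at h
      rw [sum_prod_gammaFactor_insert t Φ hx (Ne.symm h.1) fun τ => hΦ τ x, ih h.2]
  have h := key (Finset.univ.erase ⊥) (by simp)
  rw [Finset.sum_congr rfl fun τ hτ =>
      congrArg (Φ τ * ·) (prod_gammaFactor_univ t τ (Finset.mem_filter.1 hτ).2)] at h
  rw [h]
  exact Finset.sum_congr rfl fun τ _ => by rw [prod_gammaFactor_empty]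

end Gamma

/-! ### The sign-reversing involution at β = −1 -/

section SignReversing

variable {α : Type*} [LinearOrder α] [Fintype α]

/-- The sources of the edges of `τ` that cross the gap above `v` downwards. -/
def downCrossing (τ : Perm α) (v : α) : Finset α :=
  Finset.univ.filter fun c => v < c ∧ τ c ≤ v

theorem mem_downCrossing {τ : Perm α} {v c : α} : c ∈ τ.downCrossing v ↔ v < c ∧ τ c ≤ v := by
  simp [downCrossing]

variable {τ : Perm α} {v a b : α}

/-- Both sources lie above v and both targets do not, so each source exceeds either target before
and after the exchange. -/
theorem sameShapeAt_mul_swap (ha : a ∈ τ.downCrossing v) (hb : b ∈ τ.downCrossing v) (y : α) :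
    SameShapeAt τ (τ * swap a b) y := by
  obtain ⟨ha1, ha2⟩ := mem_downCrossing.1 ha
  obtain ⟨hb1, hb2⟩ := mem_downCrossing.1 hb
  have hout : (y < τ y ↔ y < (τ * swap a b) y) ∧ (τ y < y ↔ (τ * swap a b) y < y) := by
    rw [mul_apply]
    rcases eq_or_ne y a with rfl | hya
    · have h1 := ha2.trans_lt ha1
      have h2 := hb2.trans_lt ha1
      simp [h1, h2, h1.not_gt, h2.not_gt]
    rcases eq_or_ne y b with rfl | hyb
    · have h1 := ha2.trans_lt hb1
      have h2 := hb2.trans_lt hb1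
      simp [h1, h2, h1.not_gt, h2.not_gt]
    rw [swap_apply_of_ne_of_ne hya hyb]
    exact ⟨Iff.rfl, Iff.rfl⟩
  have hin : (y < τ.symm y ↔ y < (τ * swap a b).symm y) ∧
      (τ.symm y < y ↔ (τ * swap a b).symm y < y) := by
    change (_ ↔ _ < swap a b (τ.symm y)) ∧ (_ ↔ swap a b (τ.symm y) < _)
    rcases eq_or_ne (τ.symm y) a with h | hya
    · rw [h, swap_apply_left]
      rw [Equiv.symm_apply_eq] at h
      have h1 := ha2.trans_lt ha1
      have h2 := ha2.trans_lt hb1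
      simp [h, h1, h2, h1.not_gt, h2.not_gt]
    rcases eq_or_ne (τ.symm y) b with h | hyb
    · rw [h, swap_apply_right]
      rw [Equiv.symm_apply_eq] at h
      have h1 := hb2.trans_lt ha1
      have h2 := hb2.trans_lt hb1
      simp [h, h1, h2, h1.not_gt, h2.not_gt]
    rw [swap_apply_of_ne_of_ne hya hyb]
    exact ⟨Iff.rfl, Iff.rfl⟩
  exact ⟨hout.1, hout.2, hin.1, hin.2⟩

theorem downCrossing_mul_swap (ha : a ∈ τ.downCrossing v) (hb : b ∈ τ.downCrossing v) :
    (τ * swap a b).downCrossing v = τ.downCrossing v := by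
  obtain ⟨ha1, ha2⟩ := mem_downCrossing.1 ha
  obtain ⟨hb1, hb2⟩ := mem_downCrossing.1 hb
  ext y
  rw [mem_downCrossing, mem_downCrossing, mul_apply]
  rcases eq_or_ne y a with rfl | hya
  · simp [ha2, hb2]
  rcases eq_or_ne y b with rfl | hyb
  · simp [ha2, hb2]
  rw [swap_apply_of_ne_of_ne hya hyb]

/-- The edges ⊥ → ⊤ and v → τ v both cross upwards, and crossings balance. -/
theorem one_lt_card_downCrossing [BoundedOrder α] [Nontrivial α] (h0 : τ ⊥ = ⊤) (hv : v ≠ ⊥)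
    (hval : τ.IsCycValley v) : 1 < (τ.downCrossing v).card := by
  rw [downCrossing, ← card_up_crossing_eq_card_down_crossing, Finset.one_lt_card]
  refine ⟨v, by simp [hval.1], ⊥, ?_, hv⟩
  simp only [Finset.mem_filter, Finset.mem_univ, true_and, h0]
  exact ⟨bot_le, hval.1.trans_le le_top⟩

/-- The sign is −1 to the support size plus the number of nontrivial cycles; a transposition flips
it, while the support stays the same. -/
theorem neg_one_pow_card_cycleType_mul_swap (hab : a ≠ b) (ha : a ∈ τ.downCrossing v)
    (hb : b ∈ τ.downCrossing v) :
    (-1 : ℤ) ^ (Multiset.card τ.cycleType) +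
      (-1) ^ (Multiset.card (τ * swap a b).cycleType) = 0 := by
  have hsupp : (τ * swap a b).support = τ.support := by
    ext y
    rw [mem_support, mem_support, not_iff_not, (sameShapeAt_mul_swap ha hb y).apply_eq]
  have hs : sign (τ * swap a b) = - sign τ := by
    rw [sign_mul, sign_swap hab, mul_neg_one]
  rw [sign_of_cycleType, sign_of_cycleType, sum_cycleType, sum_cycleType, hsupp, pow_add, pow_add,
    ← mul_neg, mul_right_inj] at hs
  have := congrArg (fun u : ℤˣ => (u : ℤ)) hs
  push_cast at this
  rw [this, add_neg_cancel]

/-- At `β = -1` the contributions of the permutations with a valley other than the minimum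
cancel. -/
theorem sum_neg_one_pow_card_cycleType [BoundedOrder α] [Nontrivial α] {k : ℕ} (hk : 1 ≤ k) :
    ∑ τ ∈ Finset.univ.filter (fun τ : Perm α => τ ⊥ = ⊤ ∧
        (Finset.univ.filter fun y => y ≠ ⊥ ∧ τ.IsCycValley y).card = k ∧
        (Finset.univ.filter fun y => τ.IsCycDesc y).card = 0),
      (-1 : ℤ) ^ (Multiset.card τ.cycleType) = 0 := by
  -- The valley and the pair are chosen as functions of sets that the exchange preserves, so the
  -- same pair is chosen again and the map is an involution. The values ⊥ are placeholders.
  have hV : ∀ S : Finset α, ∃ v, S.Nonempty → v ∈ S := fun S => by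
    by_cases h : S.Nonempty
    · exact ⟨h.choose, fun _ => h.choose_spec⟩
    · exact ⟨⊥, fun h' => absurd h' h⟩
  have hP : ∀ S : Finset α, ∃ p : α × α, 1 < S.card → p.1 ∈ S ∧ p.2 ∈ S ∧ p.1 ≠ p.2 := fun S => by
    by_cases h : 1 < S.card
    · obtain ⟨a, ha, b, hb, hab⟩ := Finset.one_lt_card.1 h
      exact ⟨(a, b), fun _ => ⟨ha, hb, hab⟩⟩
    · exact ⟨(⊥, ⊥), fun h' => absurd h' h⟩
  choose V hV using hV
  choose P hP using hP
  set vals : Perm α → Finset α := fun τ => Finset.univ.filter fun y => y ≠ ⊥ ∧ τ.IsCycValley y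
  set pr : Perm α → α × α := fun τ => P (τ.downCrossing (V (vals τ))) with hpr
  have hpair : ∀ τ : Perm α, τ ⊥ = ⊤ → (vals τ).card = k →
      (pr τ).1 ∈ τ.downCrossing (V (vals τ)) ∧ (pr τ).2 ∈ τ.downCrossing (V (vals τ)) ∧
        (pr τ).1 ≠ (pr τ).2 := by
    intro τ h0 hc
    have hv := hV (vals τ) (Finset.card_pos.1 (by omega))
    obtain ⟨hv0, hv1⟩ := (Finset.mem_filter.1 hv).2
    exact hP _ (one_lt_card_downCrossing h0 hv0 hv1)
  have hvals : ∀ τ : Perm α, τ ⊥ = ⊤ → (vals τ).card = k →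
      vals (τ * swap (pr τ).1 (pr τ).2) = vals τ := by
    intro τ h0 hc
    obtain ⟨ha, hb, -⟩ := hpair τ h0 hc
    exact Finset.filter_congr fun y _ => by rw [(sameShapeAt_mul_swap ha hb y).isCycValley]
  refine Finset.sum_involution (fun τ _ => τ * swap (pr τ).1 (pr τ).2) ?_ ?_ ?_ ?_
  · intro τ hτ
    obtain ⟨h0, hc, -⟩ := (Finset.mem_filter.1 hτ).2
    obtain ⟨ha, hb, hab⟩ := hpair τ h0 hc
    exact neg_one_pow_card_cycleType_mul_swap hab ha hb
  · intro τ hτ _ h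
    obtain ⟨h0, hc, -⟩ := (Finset.mem_filter.1 hτ).2
    exact (hpair τ h0 hc).2.2 (swap_eq_one_iff.1 (mul_eq_left.1 h))
  · intro τ hτ
    obtain ⟨h0, hc, hd⟩ := (Finset.mem_filter.1 hτ).2
    obtain ⟨ha, hb, -⟩ := hpair τ h0 hc
    refine Finset.mem_filter.2 ⟨Finset.mem_univ _, ?_, ?_, ?_⟩
    · have ha' := (bot_le.trans_lt (mem_downCrossing.1 ha).1).ne
      have hb' := (bot_le.trans_lt (mem_downCrossing.1 hb).1).ne
      rw [mul_apply, swap_apply_of_ne_of_ne ha' hb', h0]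
    · exact (congrArg Finset.card (hvals τ h0 hc)).trans hc
    · simpa only [(sameShapeAt_mul_swap ha hb _).isCycDesc] using hd
  · intro τ hτ
    obtain ⟨h0, hc, -⟩ := (Finset.mem_filter.1 hτ).2
    obtain ⟨ha, hb, -⟩ := hpair τ h0 hc
    have e : pr (τ * swap (pr τ).1 (pr τ).2) = pr τ := by
      change P (downCrossing _ (V (vals _))) = _
      rw [hvals τ h0 hc, downCrossing_mul_swap ha hb]
    simp only [e, mul_swap_mul_self]

end SignReversing

end Equiv.Perm

open Equiv.Perm

/-! ### Translation from σ* to a permutation of {0, …, n} -/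

section StarPerm

variable {n : ℕ}

/-- The bijection `σ*` extended to `{0, …, n}` by `0 ↦ n`, which closes the path from `n` to `0`
to a cycle. -/
def starPerm (σ : Equiv.Perm (Fin n)) : Equiv.Perm (Fin (n + 1)) :=
  (finRotate (n + 1))⁻¹ * decomposeFin.symm (0, σ)

/-- `decomposeFin.symm (0, σ)` extends σ by fixing 0; the inverse rotation then lowers every value
by one and wraps 0 to n. -/
theorem starPerm_succ (σ : Equiv.Perm (Fin n)) (i : Fin n) :
    starPerm σ i.succ = starFun σ i := by
  rw [starPerm, mul_apply, Equiv.Perm.inv_def, Equiv.symm_apply_eq, starFun]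
  simp [decomposeFin_symm_apply_succ]

theorem starPerm_zero (σ : Equiv.Perm (Fin n)) : starPerm σ 0 = Fin.last n := by
  rw [starPerm, mul_apply, Equiv.Perm.inv_def, Equiv.symm_apply_eq]
  simp [decomposeFin_symm_apply_zero]

theorem starPerm_bot (σ : Equiv.Perm (Fin n)) : starPerm σ ⊥ = ⊤ :=
  starPerm_zero σ

theorem starPerm_injective : Function.Injective (starPerm (n := n)) := by
  intro σ τ h
  have := decomposeFin.symm.injective (mul_left_cancel h)
  exact (Prod.mk.inj this).2

theorem exists_starPerm_eq {τ : Equiv.Perm (Fin (n + 1))} (h : τ ⊥ = ⊤) :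
    ∃ σ : Equiv.Perm (Fin n), starPerm σ = τ := by
  obtain ⟨p, hp⟩ := decomposeFin.symm.surjective (finRotate (n + 1) * τ)
  have h0 : p.1 = 0 := by
    rw [← decomposeFin_symm_apply_zero p.1 p.2, Prod.mk.eta, hp, mul_apply]
    exact (congrArg _ h).trans finRotate_last
  refine ⟨p.2, ?_⟩
  rw [starPerm, ← h0, Prod.mk.eta, hp, inv_mul_cancel_left]

theorem sum_starPerm {M : Type*} [AddCommMonoid M] (f : Equiv.Perm (Fin (n + 1)) → M)
    (p : Equiv.Perm (Fin (n + 1)) → Prop) [DecidablePred p] :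
    ∑ σ ∈ Finset.univ.filter (fun σ : Equiv.Perm (Fin n) => p (starPerm σ)), f (starPerm σ) =
      ∑ τ ∈ Finset.univ.filter (fun τ : Equiv.Perm (Fin (n + 1)) => τ ⊥ = ⊤ ∧ p τ), f τ := by
  refine Finset.sum_bij (fun σ _ => starPerm σ) ?_ (fun _ _ _ _ h => starPerm_injective h) ?_
    (fun _ _ => rfl)
  · intro σ hσ
    exact Finset.mem_filter.2 ⟨Finset.mem_univ _, starPerm_bot σ, (Finset.mem_filter.1 hσ).2⟩
  · intro τ hτ
    obtain ⟨h0, h⟩ := (Finset.mem_filter.1 hτ).2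
    obtain ⟨σ, rfl⟩ := exists_starPerm_eq h0
    exact ⟨σ, by simpa using h, rfl⟩

theorem excNum_eq (σ : Equiv.Perm (Fin n)) :
    excNum σ = (Finset.univ.filter fun y => y ≠ ⊥ ∧ y ≤ starPerm σ y).card := by
  refine Finset.card_bij (fun i _ => i.succ) ?_ (fun _ _ _ _ h => Fin.succ_inj.1 h) ?_
  · intro i hi
    have hi' : i < σ i := (Finset.mem_filter.1 hi).2
    refine Finset.mem_filter.2 ⟨Finset.mem_univ _, Fin.succ_ne_zero i, ?_⟩
    rw [starPerm_succ, starFun, Fin.succ_le_castSucc_iff]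
    exact hi'
  · intro y hy
    obtain ⟨h0, h⟩ := (Finset.mem_filter.1 hy).2
    obtain ⟨i, rfl⟩ := Fin.exists_succ_eq.2 h0
    rw [starPerm_succ, starFun, Fin.succ_le_castSucc_iff] at h
    exact ⟨i, by simpa using h, rfl⟩

theorem fixStar_eq (σ : Equiv.Perm (Fin n)) (hn : n ≠ 0) :
    fixStar σ = (Finset.univ.filter fun y => starPerm σ y = y).card := by
  refine Finset.card_bij (fun i _ => i.succ) ?_ (fun _ _ _ _ h => Fin.succ_inj.1 h) ?_
  · intro i hi
    simpa [starPerm_succ] using hi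
  · intro y hy
    have h : starPerm σ y = y := (Finset.mem_filter.1 hy).2
    have h0 : y ≠ 0 := by
      rintro rfl
      rw [starPerm_zero] at h
      exact hn (congrArg Fin.val h)
    obtain ⟨i, rfl⟩ := Fin.exists_succ_eq.2 h0
    rw [starPerm_succ] at h
    exact ⟨i, by simpa using h, rfl⟩

/-- The conditions on `(σ*)⁻¹(x)` and `σ*(x)` in terms of `starPerm σ`. -/
theorem exists_starFun_iff (σ : Equiv.Perm (Fin n)) {r : Fin (n + 1) → Fin (n + 1) → Prop}
    {x : Fin (n + 1)} :
    (∃ i j : Fin n, starFun σ i = x ∧ j.succ = x ∧ x < i.succ ∧ r x (starFun σ j)) ↔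
      x ≠ ⊥ ∧ x < (starPerm σ).symm x ∧ r x (starPerm σ x) := by
  constructor
  · rintro ⟨i, j, hi, rfl, h1, h2⟩
    rw [← starPerm_succ, ← Equiv.eq_symm_apply] at hi
    rw [← hi, starPerm_succ]
    exact ⟨Fin.succ_ne_zero j, h1, h2⟩
  · rintro ⟨h0, h1, h2⟩
    obtain ⟨j, rfl⟩ := Fin.exists_succ_eq.2 h0
    obtain ⟨i, hi⟩ := Fin.exists_succ_eq.2 (Fin.ne_zero_of_lt h1)
    rw [starPerm_succ] at h2
    refine ⟨i, j, ?_, rfl, hi ▸ h1, h2⟩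
    rw [← starPerm_succ, hi, Equiv.apply_symm_apply]

theorem cvalleyStar_eq (σ : Equiv.Perm (Fin n)) :
    cvalleyStar σ = (Finset.univ.filter fun y => y ≠ ⊥ ∧ (starPerm σ).IsCycValley y).card := by
  unfold cvalleyStar
  congr 1
  refine Finset.filter_congr fun x _ => ?_
  rw [exists_starFun_iff σ (r := fun a b => a < b), and_comm (a := x < _)]
  rfl

theorem cddStar_eq (σ : Equiv.Perm (Fin n)) :
    cddStar σ = (Finset.univ.filter fun y => (starPerm σ).IsCycDesc y).card := by
  unfold cddStar
  congr 1
  refine Finset.filter_congr fun x _ => ?_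
  rw [exists_starFun_iff σ (r := fun a b => b < a), and_comm (a := x < _)]
  exact and_iff_right_of_imp fun h => Fin.ne_zero_of_lt h.1

theorem starEdge_iff (σ : Equiv.Perm (Fin n)) (x y : Fin (n + 1)) :
    StarEdge σ x y ↔ x ≠ 0 ∧ starPerm σ x = y := by
  constructor
  · rintro ⟨i, rfl, h⟩
    exact ⟨Fin.succ_ne_zero i, (starPerm_succ σ i).trans h⟩
  · rintro ⟨h0, h⟩
    obtain ⟨i, rfl⟩ := Fin.exists_succ_eq.2 h0
    exact ⟨i, rfl, (starPerm_succ σ i).symm.trans h⟩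

theorem sameCycle_of_transGen {σ : Equiv.Perm (Fin n)} {x y : Fin (n + 1)}
    (h : Relation.TransGen (StarEdge σ) x y) : (starPerm σ).SameCycle x y := by
  induction h with
  | single h =>
    obtain ⟨-, rfl⟩ := (starEdge_iff σ _ _).1 h
    exact (SameCycle.refl _ _).apply_right
  | tail _ h ih =>
    obtain ⟨-, rfl⟩ := (starEdge_iff σ _ _).1 h
    exact ih.apply_right

/-- Every vertex on the orbit of x still leads back to x, whereas 0 has no outgoing edge. -/
theorem not_sameCycle_zero_of_transGen {σ : Equiv.Perm (Fin n)} {x : Fin (n + 1)}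
    (h : Relation.TransGen (StarEdge σ) x x) : ¬ (starPerm σ).SameCycle x 0 := by
  have step : ∀ y, Relation.TransGen (StarEdge σ) y x →
      y ≠ 0 ∧ Relation.TransGen (StarEdge σ) (starPerm σ y) x := by
    intro y hy
    obtain ⟨z, hz, hzx⟩ := Relation.TransGen.head'_iff.1 hy
    obtain ⟨h0, rfl⟩ := (starEdge_iff σ _ _).1 hz
    refine ⟨h0, ?_⟩
    rcases Relation.reflTransGen_iff_eq_or_transGen.1 hzx with h' | h'
    · exact h' ▸ h
    · exact h'
  have hpow : ∀ k : ℕ, Relation.TransGen (StarEdge σ) ((starPerm σ ^ k) x) x := by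
    intro k
    induction k with
    | zero => exact h
    | succ k ih =>
      rw [pow_succ', mul_apply]
      exact (step _ ih).2
  intro h'
  obtain ⟨k, -, hk⟩ := h'.exists_pow_eq'
  exact (step _ (hpow k)).1 hk

theorem transGen_of_sameCycle {σ : Equiv.Perm (Fin n)} {x y : Fin (n + 1)}
    (h0 : ¬ (starPerm σ).SameCycle x 0) (h : (starPerm σ).SameCycle x y) :
    Relation.TransGen (StarEdge σ) x y := by
  have hpow : ∀ k : ℕ, (starPerm σ ^ k) x ≠ 0 := fun k hk => h0 ⟨k, by simpa using hk⟩
  have hT : ∀ k : ℕ, Relation.TransGen (StarEdge σ) x ((starPerm σ ^ (k + 1)) x) := by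
    intro k
    induction k with
    | zero => exact .single ((starEdge_iff σ _ _).2 ⟨hpow 0, by simp⟩)
    | succ k ih =>
      refine ih.tail ((starEdge_iff σ _ _).2 ⟨hpow _, ?_⟩)
      rw [pow_succ' _ (k + 1), mul_apply]
  -- A positive exponent is needed, since `TransGen` takes at least one step even when y = x.
  obtain ⟨k, hk, -, rfl⟩ := h.exists_pow_eq''
  obtain ⟨k, rfl⟩ := Nat.exists_eq_succ_of_ne_zero hk.ne'
  exact hT k

theorem starCycles_eq (σ : Equiv.Perm (Fin n)) :
    starCycles σ = {C | ∃ x, ¬ (starPerm σ).SameCycle x 0 ∧ C = {y | (starPerm σ).SameCycle x y}} := by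
  ext C
  refine exists_congr fun x => ⟨fun ⟨h, hC⟩ => ?_, fun ⟨h, hC⟩ => ?_⟩
  · have h0 := not_sameCycle_zero_of_transGen h
    refine ⟨h0, hC.trans ?_⟩
    ext y
    exact ⟨sameCycle_of_transGen, transGen_of_sameCycle h0⟩
  · refine ⟨transGen_of_sameCycle h (SameCycle.refl _ _), hC.trans ?_⟩
    ext y
    exact ⟨transGen_of_sameCycle h, sameCycle_of_transGen⟩

/-- The orbits of `τ` other than that of `o`, a point that `τ` moves. -/
theorem Equiv.Perm.ncard_sameCycle_classes {α : Type*} [Fintype α] [DecidableEq α]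
    (τ : Equiv.Perm α) {o : α} (ho : τ o ≠ o) :
    {C : Set α | ∃ x, ¬ τ.SameCycle x o ∧ C = {y | τ.SameCycle x y}}.ncard + 1 =
      Multiset.card τ.cycleType + (Finset.univ.filter fun y => τ y = y).card := by
  classical
  have hsupp : ∀ c ∈ τ.cycleFactorsFinset, ∀ x ∈ c.support,
      (c.support : Set α) = {y | τ.SameCycle x y} := by
    intro c hc x hx
    have hcx := cycle_is_cycleOf hx hc
    have hx' : τ x ≠ x := by
      have := mem_support.1 (mem_cycleFactorsFinset_support_le hc hx)
      exact this
    ext y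
    rw [Finset.mem_coe, hcx, mem_support_cycleOf_iff' hx']
    rfl
  -- An orbit avoiding o is either the support of a nontrivial cycle or a single fixed point.
  have e : {C : Set α | ∃ x, ¬ τ.SameCycle x o ∧ C = {y | τ.SameCycle x y}} =
      (fun c : Equiv.Perm α => (c.support : Set α)) ''
        (τ.cycleFactorsFinset.erase (τ.cycleOf o) : Finset (Equiv.Perm α)) ∪
      (fun x : α => ({x} : Set α)) '' (Finset.univ.filter fun y => τ y = y : Finset α) := by
    ext C
    constructor
    · rintro ⟨x, hx, rfl⟩
      by_cases hf : τ x = x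
      · refine Or.inr ⟨x, by simpa using hf, ?_⟩
        ext y
        exact ⟨fun h => h ▸ SameCycle.refl _ _, fun h => (h.eq_of_left hf).symm⟩
      · have hm : τ.cycleOf x ∈ τ.cycleFactorsFinset :=
          cycleOf_mem_cycleFactorsFinset_iff.2 (mem_support.2 hf)
        have hxs : x ∈ (τ.cycleOf x).support :=
          (mem_support_cycleOf_iff' hf).2 (SameCycle.refl _ _)
        refine Or.inl ⟨τ.cycleOf x, ?_, hsupp _ hm x hxs⟩
        refine Finset.mem_coe.2 (Finset.mem_erase.2 ⟨fun h => hx ?_, hm⟩)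
        rw [h, mem_support_cycleOf_iff' ho] at hxs
        exact hxs.symm
    · rintro (⟨c, hc, rfl⟩ | ⟨x, hx, rfl⟩)
      · obtain ⟨hne, hc⟩ := Finset.mem_erase.1 (Finset.mem_coe.1 hc)
        obtain ⟨x, hx⟩ := (mem_cycleFactorsFinset_iff.1 hc).1.nonempty_support
        refine ⟨x, fun h => hne ?_, hsupp c hc x hx⟩
        rw [cycle_is_cycleOf hx hc]
        exact h.cycleOf_eq
      · have hf : τ x = x := by simpa using hx
        refine ⟨x, fun h => ?_, ?_⟩
        · rw [h.eq_of_left hf] at hf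
          exact ho hf
        · ext y
          exact ⟨fun h => h ▸ SameCycle.refl _ _, fun h => (h.eq_of_left hf).symm⟩
  rw [e, Set.ncard_union_eq, Set.InjOn.ncard_image, Set.InjOn.ncard_image,
    Set.ncard_coe_finset, Set.ncard_coe_finset, add_right_comm, Finset.card_erase_add_one,
    cycleType_def, Multiset.card_map]
  · rfl
  · exact cycleOf_mem_cycleFactorsFinset_iff.2 (mem_support.2 ho)
  · exact fun _ _ _ _ h => Set.singleton_injective h
  · intro c hc d hd h
    have hc' := Finset.mem_of_mem_erase (Finset.mem_coe.1 hc)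
    have hd' := Finset.mem_of_mem_erase (Finset.mem_coe.1 hd)
    obtain ⟨x, hx⟩ := (mem_cycleFactorsFinset_iff.1 hc').1.nonempty_support
    have hx' : x ∈ d.support := Finset.coe_injective h ▸ hx
    rw [cycle_is_cycleOf hx hc', cycle_is_cycleOf hx' hd']
  · rw [Set.disjoint_left]
    rintro _ ⟨c, hc, rfl⟩ ⟨x, hx, hxc⟩
    have hf : τ x = x := by simpa using hx
    have hc' := Finset.mem_of_mem_erase (Finset.mem_coe.1 hc)
    have hxs : x ∈ c.support := by
      have hxc' : ({x} : Set α) = (c.support : Set α) := hxc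
      rw [← Finset.mem_coe, ← hxc']
      exact rfl
    exact mem_support.1 (mem_cycleFactorsFinset_support_le hc' hxs) hf

/-- The fixed points cancel, and the extra 1 is the closed path, a nontrivial cycle because n ≠ 0.
-/
theorem cycStar_sub_fixStar (σ : Equiv.Perm (Fin n)) (hn : n ≠ 0) :
    cycStar σ - fixStar σ + 1 = Multiset.card (starPerm σ).cycleType := by
  have h0 : starPerm σ 0 ≠ 0 := by
    rw [starPerm_zero]
    exact fun h => hn (congrArg Fin.val h)
  have h := ncard_sameCycle_classes (starPerm σ) h0
  rw [← starCycles_eq, ← fixStar_eq σ hn] at h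
  have := fixStar_le_cycStar σ
  unfold cycStar at this ⊢
  omega

end StarPerm

/-! ### Conclusion -/

theorem isRoot_dPoly (n k : ℕ) (hn : n ≠ 0) (hk : 1 ≤ k) : (dPoly n k).IsRoot (-1) := by
  have : Nontrivial (Fin (n + 1)) := Fin.nontrivial_iff_two_le.2 (by omega)
  rw [IsRoot, dPoly, eval_finsetSum]
  simp only [eval_pow, eval_X, cvalleyStar_eq, cddStar_eq]
  -- The exponents differ by one, the cycle through 0, so the two sums are opposite.
  rw [← neg_eq_zero, ← Finset.sum_neg_distrib, ← sum_neg_one_pow_card_cycleType (α := Fin (n + 1)) hk,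
    ← sum_starPerm]
  refine Finset.sum_congr rfl fun σ _ => ?_
  rw [← cycStar_sub_fixStar σ hn, pow_succ, mul_neg_one]

theorem two_mul_cvalleyStar_le {n : ℕ} (σ : Equiv.Perm (Fin n)) (hn : n ≠ 0) :
    2 * cvalleyStar σ ≤ n - 1 := by
  have : Nontrivial (Fin (n + 1)) := Fin.nontrivial_iff_two_le.2 (by omega)
  have h1 := card_isCycDesc_add (starPerm σ)
  have h2 := card_isCycValley_eq (starPerm_bot σ)
  rw [← cvalleyStar_eq] at h2
  rw [Fintype.card_fin] at h1
  omega

theorem sum_dPoly_mul_pow (n : ℕ) (hn : n ≠ 0) :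
    ∑ k ∈ Finset.range ((n - 1) / 2 + 1),
        C (dPoly n k) * (X : ℤ[X][X]) ^ k * (1 + X) ^ (n - 1 - 2 * k) =
      ∑ σ : Equiv.Perm (Fin n), C ((X : ℤ[X]) ^ (cycStar σ - fixStar σ)) *
        if cddStar σ = 0 then X ^ cvalleyStar σ * (1 + X) ^ (n - 1 - 2 * cvalleyStar σ) else 0 := by
  rw [← Finset.sum_fiberwise_of_maps_to (g := cvalleyStar)
    (t := Finset.range ((n - 1) / 2 + 1))]
  · refine Finset.sum_congr rfl fun k _ => ?_
    rw [dPoly, map_sum, mul_assoc, Finset.sum_mul, ← Finset.filter_filter, Finset.sum_filter]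
    refine Finset.sum_congr rfl fun σ hσ => ?_
    rw [(Finset.mem_filter.1 hσ).2, mul_ite, mul_zero]
  · intro σ _
    have := two_mul_cvalleyStar_le σ hn
    rw [Finset.mem_range]
    omega

/-- The expansion is an identity in `ℤ[β][t]`: the inner variable is `β` (as a coefficient, `C X`),
the outer variable is `t`. -/
theorem mainTheorem7 (n : ℕ) (hn : 1 ≤ n) :
    (∑ σ : Equiv.Perm (Fin n),
        C ((X : ℤ[X]) ^ (cycStar σ - fixStar σ)) * (X : ℤ[X][X]) ^ excNum σ =
      ∑ k ∈ Finset.range ((n - 1) / 2 + 1),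
        C (dPoly n k) * (X : ℤ[X][X]) ^ k * (1 + X) ^ (n - 1 - 2 * k)) ∧
    ∀ k : ℕ, 1 ≤ k → (X + 1 : ℤ[X]) ∣ dPoly n k := by
  have hn0 : n ≠ 0 := by omega
  have : Nontrivial (Fin (n + 1)) := Fin.nontrivial_iff_two_le.2 (by omega)
  constructor
  · have h := sum_mul_pow_eq_gamma_expansion (α := Fin (n + 1)) (X : ℤ[X][X])
      (fun τ => C ((X : ℤ[X]) ^ (Multiset.card τ.cycleType - 1)))
      (fun τ x hx => by rw [card_cycleType_hop hx])
    have hs := fun f : Equiv.Perm (Fin (n + 1)) → ℤ[X][X] => sum_starPerm f fun _ => True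
    simp only [Finset.filter_true, and_true] at hs
    rw [← hs, ← hs] at h
    rw [sum_dPoly_mul_pow n hn0]
    have hcard : Fintype.card (Fin (n + 1)) - 2 = n - 1 := by simp
    simpa only [← cycStar_sub_fixStar _ hn0, Nat.add_sub_cancel, ← excNum_eq, ← cvalleyStar_eq,
      ← cddStar_eq, hcard] using h
  · intro k hk
    have := dvd_iff_isRoot.2 (isRoot_dPoly n k hn0 hk)
    simpa using this
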